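/- Let $n \ge 2$ and let $G$ be a consistently oriented cycle graph on the vertex set $\mathbb{Z}/n\mathbb{Z}$, that is, a weight function $\omega : \mathbb{Z}/n\mathbb{Z} \times \mathbb{Z}/n\mathbb{Z} \to [0,\infty]$ such that $\omega(i,j) < \infty$ if and only if $j = i+1 \pmod n$. Let $P(G)$ be its path completion, whose weight $d(x,y)$ is the infimum of $\sum_{k<m} \omega(x_k,x_{k+1})$ over all finite sequences $x = x_0, x_1, \dots, x_m = y$ of vertices with $m \ge 0$ (the constant sequence has weight $0$). For $\delta \in [0,\infty]$ let $\mathfrak{D}_\delta(G)$ be the Dowker source complex of $P(G)$ at $\delta$: its simplices are the nonempty finite sets $\sigma$ of vertices for which there is a vertex $v$ with $d(v,x) \le \delta$ for all $x \in \sigma$. Suppose that $\delta \ge \max_i \omega(i,i+1)$. Then the first simplicial homology group $H_1(\mathfrak{D}_\delta(G);\mathbb{R})$ is trivial if and only if there exist two distinct vertices $y_1 \ne y_2$ with $d(y_1,y_2) \le \delta$ and $d(y_2,y_1) \le \delta$. -/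

import Mathlib

universe u

open scoped ENNReal

noncomputable section

/-- A network (weighted digraph) on the vertex set `V`: a weight in `[0, ∞]` for every ordered
pair of vertices, where the weight `∞` means that there is no edge. -/
structure WeightedDigraph (V : Type*) where
  weight : V → V → ℝ≥0∞

namespace WeightedDigraph

variable {V : Type*}

/-- The shortest path function: the infimum over all finite vertex sequences `p 0, …, p m` with
`p 0 = x` and `p m = y` of the sum of the weights of consecutive pairs. The constant path `m = 0`
has weight `0`. -/
def shortestPath (G : WeightedDigraph V) (x y : V) : ℝ≥0∞ :=
  ⨅ (m : ℕ) (p : Fin (m + 1) → V) (_ : p 0 = x) (_ : p (Fin.last m) = y),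
    ∑ i : Fin m, G.weight (p i.castSucc) (p i.succ)

/-- The path completion `P(G)`. -/
def pathCompletion (G : WeightedDigraph V) : WeightedDigraph V where
  weight := G.shortestPath

/-- The relation `R_δ(G)`: `x` sees `y` within `δ`. -/
def rel (G : WeightedDigraph V) (δ : ℝ≥0∞) (x y : V) : Prop :=
  G.weight x y ≤ δ

/-- A consistently oriented cycle graph on the vertices `0, …, n - 1`: the edges of finite weight
are exactly those from `i` to `i + 1`, the addition being modulo `n`. -/
def IsConsistentlyOrientedCycle {n : ℕ} [NeZero n] (G : WeightedDigraph (Fin n)) : Prop :=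
  ∀ i j : Fin n, G.weight i j < ∞ ↔ j = i + 1

end WeightedDigraph

/-- The Dowker source complex of a relation: a nonempty finite set of vertices is a simplex when
a common source is related to all its elements. -/
def dowkerSourceComplex {X Y : Type*} (R : Y → X → Prop) : PreAbstractSimplicialComplex X where
  faces := {σ | σ.Nonempty ∧ ∃ y, ∀ x ∈ σ, R y x}
  isRelLowerSet_faces := by
    rintro σ ⟨hσ, y, hy⟩
    exact ⟨hσ, fun τ hτ hne => ⟨hne, y, fun x hx => hy x (hτ hx)⟩⟩

/-- The complex `𝔇_δ(G)`: the Dowker source complex of `R_δ(P(G))`. -/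
def WeightedDigraph.dowkerComplex {V : Type*} (G : WeightedDigraph V) (δ : ℝ≥0∞) :
    PreAbstractSimplicialComplex V :=
  dowkerSourceComplex (G.pathCompletion.rel δ)

namespace PreAbstractSimplicialComplex

variable {V : Type u} [LinearOrder V]

/-- The `k`-simplices: the faces with `k + 1` vertices. -/
@[ext]
structure Simplex (K : PreAbstractSimplicialComplex V) (k : ℕ) where
  verts : Finset V
  mem_faces : verts ∈ K.faces
  card_eq : verts.card = k + 1

/-- The space of `k`-chains with real coefficients. -/
abbrev Chain (K : PreAbstractSimplicialComplex V) (k : ℕ) : Type u :=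
  K.Simplex k →₀ ℝ

instance (K : PreAbstractSimplicialComplex V) (k : ℕ) : AddCommGroup (K.Chain k) :=
  Finsupp.instAddCommGroup

/-- The `i`-th vertex, in increasing order, of a `k`-simplex. -/
def Simplex.vertex {K : PreAbstractSimplicialComplex V} {k : ℕ} (σ : K.Simplex k)
    (i : Fin (k + 1)) : V :=
  σ.verts.orderEmbOfFin σ.card_eq i

/-- The simplex obtained by omitting the `i`-th vertex. -/
def Simplex.face {K : PreAbstractSimplicialComplex V} {k : ℕ} (σ : K.Simplex (k + 1))
    (i : Fin (k + 2)) : K.Simplex k :=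
  have hcard : (σ.verts.erase (σ.vertex i)).card = k + 1 := by
    have hmem : σ.vertex i ∈ σ.verts := Finset.orderEmbOfFin_mem _ _ _
    rw [Finset.card_erase_of_mem hmem, σ.card_eq]
    rfl
  { verts := σ.verts.erase (σ.vertex i)
    mem_faces := (K.isRelLowerSet_faces σ.mem_faces).2 (Finset.erase_subset _ _)
      (Finset.card_pos.1 (by omega))
    card_eq := hcard }

/-- The boundary map from `(k + 1)`-chains to `k`-chains,
`∂ [v₀, …, v_{k+1}] = ∑ i, (-1)^i [v₀, …, v̂ᵢ, …, v_{k+1}]`. -/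
def boundary (K : PreAbstractSimplicialComplex V) (k : ℕ) : K.Chain (k + 1) →ₗ[ℝ] K.Chain k :=
  Finsupp.linearCombination ℝ fun σ : K.Simplex (k + 1) =>
    ∑ i : Fin (k + 2), Finsupp.single (σ.face i) ((-1 : ℝ) ^ (i : ℕ))

/-- The `k`-cycles: the kernel of the boundary map on `k`-chains, which is zero for `k = 0`. -/
def cycles (K : PreAbstractSimplicialComplex V) : (k : ℕ) → Submodule ℝ (K.Chain k)
  | 0 => ⊤
  | k + 1 => LinearMap.ker (K.boundary k)

/-- The `k`-th simplicial homology with real coefficients: `k`-cycles modulo `k`-boundaries. -/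
abbrev Homology (K : PreAbstractSimplicialComplex V) (k : ℕ) : Type u :=
  K.cycles k ⧸ (LinearMap.range (K.boundary k)).submoduleOf (K.cycles k)

end PreAbstractSimplicialComplex

end

/-! Going once round the cycle is, up to boundaries, the only possible source of first homology, and
the question is whether this loop bounds. Every finite path runs forwards, so the vertices seen from
`v` form an arc starting at `v`.

If no two distinct vertices see each other, each edge of the complex has a well-defined direction.
The signed number of steps along it is an alternating cocycle (`signedSteps_eq`), whose sum over the
loop `i → i + 1` is `n ≠ 0`; hence the homology is nontrivial
(`sum_cocycle_eq_zero_of_subsingleton`).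

If `y₁` and `y₂` see each other, the arcs `y₁ → y₂` and `y₂ → y₁` together make one full turn, while
the two edges cancel. So the loop is null modulo boundaries, partial sums of unit edges around the
cycle are periodic, and they give a potential for all edge classes (`exists_potential`). A potential
makes every cycle a boundary (`subsingleton_homology_one_of_potential`). -/

namespace PreAbstractSimplicialComplex

/-! ### Oriented edges, cocycles and first homology. -/

section Edges

theorem mem_faces_of_subset {V : Type u} {K : PreAbstractSimplicialComplex V} {s t : Finset V}
    (hs : s ∈ K.faces) (hts : t ⊆ s) (ht : t.Nonempty) : t ∈ K.faces :=
  (K.isRelLowerSet_faces hs).2 hts ht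

variable {V : Type u} [LinearOrder V] (K : PreAbstractSimplicialComplex V)

theorem Simplex.vertex_mem {K : PreAbstractSimplicialComplex V} {k : ℕ} (σ : K.Simplex k)
    (i : Fin (k + 1)) : σ.vertex i ∈ σ.verts :=
  Finset.orderEmbOfFin_mem _ _ _

theorem Simplex.vertex_strictMono {K : PreAbstractSimplicialComplex V} {k : ℕ}
    (σ : K.Simplex k) : StrictMono σ.vertex :=
  (σ.verts.orderEmbOfFin σ.card_eq).strictMono

theorem Simplex.vertex_face {K : PreAbstractSimplicialComplex V} {k : ℕ}
    (σ : K.Simplex (k + 1)) (i : Fin (k + 2)) (j : Fin (k + 1)) :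
    (σ.face i).vertex j = σ.vertex (i.succAbove j) := by
  have h := Finset.orderEmbOfFin_unique (s := (σ.face i).verts) (σ.face i).card_eq
    (f := fun j => σ.vertex (i.succAbove j))
    (fun j => Finset.mem_erase.2 ⟨fun e => Fin.succAbove_ne i j
      (σ.vertex_strictMono.injective e), σ.vertex_mem _⟩)
    (σ.vertex_strictMono.comp (Fin.strictMono_succAbove i))
  exact (congrFun h j).symm

/-- The `1`-simplex with the vertices `a < b`. -/
def edgeSimplex {K : PreAbstractSimplicialComplex V} {a b : V} (h : {a, b} ∈ K.faces)
    (hab : a < b) : K.Simplex 1 where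
  verts := {a, b}
  mem_faces := h
  card_eq := Finset.card_pair hab.ne

open Classical in
/-- The oriented edge from `a` to `b` as a `1`-chain; it is zero when `a = b` or when `{a, b}` is
not a face. -/
noncomputable def edge (a b : V) : K.Chain 1 :=
  if h : {a, b} ∈ K.faces ∧ a < b then Finsupp.single (edgeSimplex h.1 h.2) 1
  else if h : {b, a} ∈ K.faces ∧ b < a then -Finsupp.single (edgeSimplex h.1 h.2) 1
  else 0

variable {K}

theorem edge_of_lt {a b : V} (h : {a, b} ∈ K.faces) (hab : a < b) :
    K.edge a b = Finsupp.single (edgeSimplex h hab) 1 := by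
  simp [edge, h, hab]

theorem edge_self (a : V) : K.edge a a = 0 := by
  simp [edge]

theorem edge_swap (a b : V) : K.edge b a = -K.edge a b := by
  rcases lt_trichotomy a b with hab | rfl | hab
  · by_cases h : {a, b} ∈ K.faces <;> simp [edge, hab, hab.not_gt, h]
  · simp [edge_self]
  · by_cases h : {b, a} ∈ K.faces <;> simp [edge, hab, hab.not_gt, h]

theorem Simplex.vertex_zero_lt_one (σ : K.Simplex 1) : σ.vertex 0 < σ.vertex 1 :=
  σ.vertex_strictMono (by decide)

theorem Simplex.pair_vertex_eq (σ : K.Simplex 1) :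
    ({σ.vertex 0, σ.vertex 1} : Finset V) = σ.verts := by
  refine Finset.eq_of_subset_of_card_le ?_ ?_
  · intro x hx
    rcases Finset.mem_insert.1 hx with rfl | hx
    · exact σ.vertex_mem 0
    · rw [Finset.mem_singleton.1 hx]
      exact σ.vertex_mem 1
  · rw [σ.card_eq, Finset.card_pair σ.vertex_zero_lt_one.ne]

theorem Simplex.pair_vertex_mem_faces (σ : K.Simplex 1) :
    {σ.vertex 0, σ.vertex 1} ∈ K.faces :=
  σ.pair_vertex_eq ▸ σ.mem_faces

theorem single_eq_edge (σ : K.Simplex 1) :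
    (Finsupp.single σ 1 : K.Chain 1) = K.edge (σ.vertex 0) (σ.vertex 1) := by
  rw [edge_of_lt σ.pair_vertex_mem_faces σ.vertex_zero_lt_one]
  congr 1
  exact Simplex.ext σ.pair_vertex_eq.symm

theorem vertex_edgeSimplex {a b : V} (h : {a, b} ∈ K.faces) (hab : a < b) :
    (edgeSimplex h hab).vertex 0 = a ∧ (edgeSimplex h hab).vertex 1 = b := by
  have hlt := (edgeSimplex h hab).vertex_zero_lt_one
  have h0 := (edgeSimplex h hab).vertex_mem 0
  have h1 := (edgeSimplex h hab).vertex_mem 1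
  simp only [edgeSimplex, Finset.mem_insert, Finset.mem_singleton] at h0 h1
  change (edgeSimplex h hab).vertex 0 = a ∨ (edgeSimplex h hab).vertex 0 = b at h0
  change (edgeSimplex h hab).vertex 1 = a ∨ (edgeSimplex h hab).vertex 1 = b at h1
  rcases h0 with h0 | h0 <;> rcases h1 with h1 | h1 <;> rw [h0, h1] at hlt
  · exact absurd hlt (lt_irrefl _)
  · exact ⟨h0, h1⟩
  · exact absurd hlt hab.not_gt
  · exact absurd hlt (lt_irrefl _)

/-- A linear map on `1`-chains that is the linear extension of an alternating function takes the
expected values on all oriented edges. -/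
theorem linearCombination_edge {M : Type*} [AddCommGroup M] [Module ℝ M] (F : V → V → M)
    (hF : ∀ a b, {a, b} ∈ K.faces → F b a = -F a b) {a b : V} (h : {a, b} ∈ K.faces) :
    Finsupp.linearCombination ℝ (fun σ : K.Simplex 1 => F (σ.vertex 0) (σ.vertex 1))
      (K.edge a b) = F a b := by
  have key : ∀ a b, {a, b} ∈ K.faces → a < b →
      Finsupp.linearCombination ℝ (fun σ : K.Simplex 1 => F (σ.vertex 0) (σ.vertex 1))
        (K.edge a b) = F a b := by
    intro a b h hab
    rw [edge_of_lt h hab, Finsupp.linearCombination_single, one_smul,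
      (vertex_edgeSimplex h hab).1, (vertex_edgeSimplex h hab).2]
  rcases lt_trichotomy a b with hab | rfl | hab
  · exact key a b h hab
  · have h2 := hF a a h
    have : (2 : ℝ) • F a a = 0 := by rw [two_smul]; nth_rewrite 1 [h2]; simp
    rw [edge_self, map_zero]
    exact ((smul_eq_zero.1 this).resolve_left two_ne_zero).symm
  · have h' : {b, a} ∈ K.faces := Finset.pair_comm a b ▸ h
    rw [edge_swap b a, map_neg, key b a h' hab, hF b a h']

theorem boundary_one_single (σ : K.Simplex 2) :
    K.boundary 1 (Finsupp.single σ 1) =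
      K.edge (σ.vertex 0) (σ.vertex 1) + K.edge (σ.vertex 1) (σ.vertex 2)
        - K.edge (σ.vertex 0) (σ.vertex 2) := by
  have h : ∀ i : Fin 3, ∀ c : ℝ, (Finsupp.single (σ.face i) c : K.Chain 1) =
      c • K.edge (σ.vertex (i.succAbove 0)) (σ.vertex (i.succAbove 1)) := by
    intro i c
    rw [← σ.vertex_face, ← σ.vertex_face, ← single_eq_edge, Finsupp.smul_single, smul_eq_mul,
      mul_one]
  have e0 : (0 : Fin 3).succAbove (0 : Fin 2) = 1 := rfl
  have e1 : (0 : Fin 3).succAbove (1 : Fin 2) = 2 := rfl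
  have e2 : (1 : Fin 3).succAbove (0 : Fin 2) = 0 := rfl
  have e3 : (1 : Fin 3).succAbove (1 : Fin 2) = 2 := rfl
  have e4 : (2 : Fin 3).succAbove (0 : Fin 2) = 0 := rfl
  have e5 : (2 : Fin 3).succAbove (1 : Fin 2) = 1 := rfl
  rw [boundary, Finsupp.linearCombination_single, one_smul]
  simp only [h]
  rw [Fin.sum_univ_three, e0, e1, e2, e3, e4, e5]
  simp only [Fin.val_zero, Fin.val_one, Fin.val_two, pow_zero, pow_one, one_smul, neg_smul,
    even_two.neg_one_pow]
  abel

theorem triple_vertex_mem_faces (σ : K.Simplex 2) :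
    {σ.vertex 0, σ.vertex 1, σ.vertex 2} ∈ K.faces := by
  refine mem_faces_of_subset σ.mem_faces ?_ ⟨_, Finset.mem_insert_self _ _⟩
  intro x hx
  simp only [Finset.mem_insert, Finset.mem_singleton] at hx
  rcases hx with rfl | rfl | rfl <;> exact σ.vertex_mem _

theorem edge_triangle_mem_range_of_lt {a b c : V} (h : {a, b, c} ∈ K.faces) (hab : a < b)
    (hbc : b < c) : K.edge a b + K.edge b c - K.edge a c ∈ LinearMap.range (K.boundary 1) := by
  let σ : K.Simplex 2 := ⟨{a, b, c}, h, Finset.card_eq_three.2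
    ⟨a, b, c, hab.ne, (hab.trans hbc).ne, hbc.ne, rfl⟩⟩
  have hv : ∀ i : Fin 3, ![a, b, c] i = σ.vertex i := by
    have := Finset.orderEmbOfFin_unique (s := σ.verts) σ.card_eq (f := ![a, b, c])
      (by intro i; fin_cases i <;> simp [σ])
      (by
        refine Fin.strictMono_iff_lt_succ.2 fun i => ?_
        fin_cases i
        · exact hab
        · exact hbc)
    exact fun i => congrFun this i
  have h0 : σ.vertex 0 = a := (hv 0).symm
  have h1 : σ.vertex 1 = b := (hv 1).symm
  have h2 : σ.vertex 2 = c := (hv 2).symm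
  refine ⟨Finsupp.single σ 1, ?_⟩
  rw [boundary_one_single, h0, h1, h2]

/-- Triangles with a repeated vertex contribute zero. For distinct vertices the expression changes
only by the sign of the permutation, so the increasing order suffices. -/
theorem edge_triangle_mem_range {a b c : V} (h : {a, b, c} ∈ K.faces) :
    K.edge a b + K.edge b c - K.edge a c ∈ LinearMap.range (K.boundary 1) := by
  rcases eq_or_ne a b with rfl | hab
  · simp [edge_self]
  rcases eq_or_ne b c with rfl | hbc
  · simp [edge_self]
  rcases eq_or_ne a c with rfl | hac
  · simp [edge_self, edge_swap a b]
  have key : ∀ x y z : V, ({x, y, z} : Finset V) = {a, b, c} → x < y → y < z →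
      K.edge x y + K.edge y z - K.edge x z ∈ LinearMap.range (K.boundary 1) :=
    fun x y z e hxy hyz => edge_triangle_mem_range_of_lt (e ▸ h) hxy hyz
  rcases lt_or_gt_of_ne hab with h1 | h1 <;> rcases lt_or_gt_of_ne hbc with h2 | h2
  · exact key a b c rfl h1 h2
  · rcases lt_or_gt_of_ne hac with h3 | h3
    · have := neg_mem (key a c b (by ext; simp; tauto) h3 h2)
      rw [edge_swap b c] at this
      convert this using 1; abel
    · have := key c a b (by ext; simp; tauto) h3 h1
      rw [edge_swap b c, edge_swap a c] at this
      convert this using 1; abel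
  · rcases lt_or_gt_of_ne hac with h3 | h3
    · have := neg_mem (key b a c (by ext; simp; tauto) h1 h3)
      rw [edge_swap a b] at this
      convert this using 1; abel
    · have := key b c a (by ext; simp; tauto) h2 h3
      rw [edge_swap a b, edge_swap a c] at this
      convert this using 1; abel
  · have := neg_mem (key c b a (by ext; simp; tauto) h2 h1)
    rw [edge_swap a b, edge_swap a c, edge_swap b c] at this
    convert this using 1; abel

variable (K) in
open Classical in
/-- The vertex `a` as a `0`-chain; it is zero when `{a}` is not a face. -/
noncomputable def point (a : V) : K.Chain 0 :=
  if h : {a} ∈ K.faces then Finsupp.single ⟨{a}, h, Finset.card_singleton a⟩ 1 else 0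

theorem single_eq_point (σ : K.Simplex 0) :
    (Finsupp.single σ 1 : K.Chain 0) = K.point (σ.vertex 0) := by
  have hv : ({σ.vertex 0} : Finset V) = σ.verts :=
    Finset.eq_of_subset_of_card_le (Finset.singleton_subset_iff.2 (σ.vertex_mem 0))
      (by rw [σ.card_eq, Finset.card_singleton])
  have hf : {σ.vertex 0} ∈ K.faces := hv ▸ σ.mem_faces
  rw [point, dif_pos hf]
  congr 1
  exact Simplex.ext hv.symm

theorem boundary_zero_single (σ : K.Simplex 1) :
    K.boundary 0 (Finsupp.single σ 1) = K.point (σ.vertex 1) - K.point (σ.vertex 0) := by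
  have h : ∀ i : Fin 2, ∀ c : ℝ, (Finsupp.single (σ.face i) c : K.Chain 0) =
      c • K.point (σ.vertex (i.succAbove 0)) := by
    intro i c
    rw [← σ.vertex_face, ← single_eq_point, Finsupp.smul_single, smul_eq_mul, mul_one]
  have e0 : (0 : Fin 2).succAbove (0 : Fin 1) = 1 := rfl
  have e1 : (1 : Fin 2).succAbove (0 : Fin 1) = 0 := rfl
  rw [boundary, Finsupp.linearCombination_single, one_smul]
  simp only [h]
  rw [Fin.sum_univ_two, e0, e1]
  simp [sub_eq_add_neg]

theorem boundary_zero_eq_linearCombination :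
    K.boundary 0 = Finsupp.linearCombination ℝ fun σ : K.Simplex 1 =>
      K.point (σ.vertex 1) - K.point (σ.vertex 0) := by
  ext1 σ
  refine LinearMap.ext_ring ?_
  simp only [LinearMap.comp_apply, Finsupp.lsingle_apply]
  rw [boundary_zero_single, Finsupp.linearCombination_single, one_smul]

theorem boundary_zero_edge {a b : V} (h : {a, b} ∈ K.faces) :
    K.boundary 0 (K.edge a b) = K.point b - K.point a := by
  rw [boundary_zero_eq_linearCombination]
  exact linearCombination_edge (fun a b => K.point b - K.point a)
    (fun a b _ => (neg_sub _ _).symm) h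

theorem subsingleton_homology_one_iff :
    Subsingleton (K.Homology 1) ↔
      LinearMap.ker (K.boundary 0) ≤ LinearMap.range (K.boundary 1) := by
  rw [Submodule.Quotient.subsingleton_iff, Submodule.submoduleOf_eq_top]
  rfl

/-- The first homology vanishes when every edge is, modulo boundaries, the coboundary of a
function on the vertices. -/
theorem subsingleton_homology_one_of_potential
    (g : V → K.Chain 1 ⧸ LinearMap.range (K.boundary 1))
    (hg : ∀ a b, {a, b} ∈ K.faces →
      (LinearMap.range (K.boundary 1)).mkQ (K.edge a b) = g b - g a) :
    Subsingleton (K.Homology 1) := by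
  rw [subsingleton_homology_one_iff]
  intro z hz
  let H : K.Chain 0 →ₗ[ℝ] K.Chain 1 ⧸ LinearMap.range (K.boundary 1) :=
    Finsupp.linearCombination ℝ fun σ => g (σ.vertex 0)
  have hp : ∀ a, {a} ∈ K.faces → H (K.point a) = g a := by
    intro a ha
    rw [point, dif_pos ha, Finsupp.linearCombination_single, one_smul]
    congr 1
    have := Simplex.vertex_mem (⟨{a}, ha, Finset.card_singleton a⟩ : K.Simplex 0) 0
    exact Finset.mem_singleton.1 this
  -- The quotient map factors through the boundary, so it kills cycles.
  have hH : (LinearMap.range (K.boundary 1)).mkQ = H ∘ₗ K.boundary 0 := by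
    ext1 σ
    refine LinearMap.ext_ring ?_
    simp only [LinearMap.comp_apply, Finsupp.lsingle_apply]
    rw [boundary_zero_single, map_sub, hp, hp, single_eq_edge, hg _ _ σ.pair_vertex_mem_faces]
    · exact mem_faces_of_subset σ.mem_faces (Finset.singleton_subset_iff.2 (σ.vertex_mem _))
        (Finset.singleton_nonempty _)
    · exact mem_faces_of_subset σ.mem_faces (Finset.singleton_subset_iff.2 (σ.vertex_mem _))
        (Finset.singleton_nonempty _)
  have : (LinearMap.range (K.boundary 1)).mkQ z = 0 := by
    rw [hH, LinearMap.comp_apply, LinearMap.mem_ker.1 hz, map_zero]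
  simpa using this

/-- If the first homology vanishes, then every alternating `1`-cocycle has vanishing sum over
every closed edge path. -/
theorem sum_cocycle_eq_zero_of_subsingleton (hK : Subsingleton (K.Homology 1))
    (F : V → V → ℝ) (hF : ∀ a b, {a, b} ∈ K.faces → F b a = -F a b)
    (hF' : ∀ a b c, {a, b, c} ∈ K.faces → F a b + F b c = F a c)
    {ι : Type*} (s : Finset ι) (a b : ι → V) (hab : ∀ i ∈ s, {a i, b i} ∈ K.faces)
    (hs : ∑ i ∈ s, K.point (b i) = ∑ i ∈ s, K.point (a i)) :
    ∑ i ∈ s, F (a i) (b i) = 0 := by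
  rw [subsingleton_homology_one_iff] at hK
  have hz : ∑ i ∈ s, K.edge (a i) (b i) ∈ LinearMap.ker (K.boundary 0) := by
    rw [LinearMap.mem_ker, map_sum, Finset.sum_congr rfl fun i hi => boundary_zero_edge (hab i hi),
      Finset.sum_sub_distrib, hs, sub_self]
  obtain ⟨w, hw⟩ := hK hz
  let L : K.Chain 1 →ₗ[ℝ] ℝ :=
    Finsupp.linearCombination ℝ fun σ : K.Simplex 1 => F (σ.vertex 0) (σ.vertex 1)
  have hL : ∀ a b, {a, b} ∈ K.faces → L (K.edge a b) = F a b :=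
    fun a b h => linearCombination_edge F hF h
  have hLb : L ∘ₗ K.boundary 1 = 0 := by
    ext1 σ
    refine LinearMap.ext_ring ?_
    simp only [LinearMap.comp_apply, Finsupp.lsingle_apply]
    have hσ := triple_vertex_mem_faces σ
    have hsub : ∀ x y, x ∈ ({σ.vertex 0, σ.vertex 1, σ.vertex 2} : Finset V) →
        y ∈ ({σ.vertex 0, σ.vertex 1, σ.vertex 2} : Finset V) → {x, y} ∈ K.faces :=
      fun x y hx hy => mem_faces_of_subset hσ
        (Finset.insert_subset hx (Finset.singleton_subset_iff.2 hy)) ⟨x, by simp⟩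
    rw [boundary_one_single, map_sub, map_add, hL _ _ (hsub _ _ (by simp) (by simp)),
      hL _ _ (hsub _ _ (by simp) (by simp)), hL _ _ (hsub _ _ (by simp) (by simp)), hF' _ _ _ hσ,
      sub_self]
    rfl
  calc ∑ i ∈ s, F (a i) (b i) = L (∑ i ∈ s, K.edge (a i) (b i)) := by
        rw [map_sum]; exact Finset.sum_congr rfl fun i hi => (hL _ _ (hab i hi)).symm
    _ = (L ∘ₗ K.boundary 1) w := by rw [← hw]; rfl
    _ = 0 := by rw [hLb]; rfl

end Edges

end PreAbstractSimplicialComplex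

/-- The number of steps from `a` to `b` in the positive direction around the cycle. -/
def Fin.stepsTo {n : ℕ} (a b : Fin n) : ℕ := (b - a).val

/-! ### Counting steps around the cycle. -/

namespace Fin

section Steps

open scoped Fin.CommRing

theorem stepsTo_lt {n : ℕ} (a b : Fin n) : a.stepsTo b < n := (b - a).isLt

variable {n : ℕ} [NeZero n]

theorem add_stepsTo (a b : Fin n) : a + (a.stepsTo b : Fin n) = b := by
  rw [stepsTo, Fin.cast_val_eq_self]
  exact add_sub_cancel a b

theorem stepsTo_add_natCast (a : Fin n) (m : ℕ) : a.stepsTo (a + (m : Fin n)) = m % n := by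
  rw [stepsTo, add_sub_cancel_left, Fin.val_natCast]

theorem stepsTo_add_one (hn : 2 ≤ n) (a : Fin n) : a.stepsTo (a + 1) = 1 := by
  simpa [Nat.mod_eq_of_lt hn] using stepsTo_add_natCast a 1

theorem stepsTo_eq_zero_iff {a b : Fin n} : a.stepsTo b = 0 ↔ a = b := by
  rw [stepsTo, Fin.val_eq_zero_iff, sub_eq_zero, eq_comm]

theorem stepsTo_eq_sub {v a b : Fin n} (h : v.stepsTo a ≤ v.stepsTo b) :
    a.stepsTo b = v.stepsTo b - v.stepsTo a := by
  have h1 : b = a + ((v.stepsTo b - v.stepsTo a : ℕ) : Fin n) := by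
    conv_lhs => rw [← add_stepsTo v b, ← Nat.add_sub_cancel' h]
    conv_rhs => rw [← add_stepsTo v a]
    push_cast
    rw [add_stepsTo, ← add_assoc, add_stepsTo]
  conv_lhs => rw [h1]
  rw [stepsTo_add_natCast, Nat.mod_eq_of_lt]
  exact lt_of_le_of_lt (Nat.sub_le _ _) (stepsTo_lt v b)

theorem stepsTo_add_stepsTo {a b : Fin n} (h : a ≠ b) : a.stepsTo b + b.stepsTo a = n := by
  have h1 : 0 < a.stepsTo b := Nat.pos_of_ne_zero (mt stepsTo_eq_zero_iff.1 h)
  have h2 := stepsTo_lt a b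
  have h3 : a = b + ((n - a.stepsTo b : ℕ) : Fin n) := by
    conv_rhs => rw [← add_stepsTo a b]
    rw [add_stepsTo]
    have : b + ((n - a.stepsTo b : ℕ) : Fin n) + (a.stepsTo b : Fin n) =
        a + (a.stepsTo b : Fin n) := by
      rw [add_assoc, ← Nat.cast_add, Nat.sub_add_cancel h2.le, Fin.natCast_self, add_zero,
        add_stepsTo]
    exact (add_right_cancel this).symm
  have h4 : b.stepsTo a = n - a.stepsTo b := by
    conv_lhs => rw [h3]
    rw [stepsTo_add_natCast, Nat.mod_eq_of_lt (by omega)]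
  omega

end Steps

end Fin

namespace WeightedDigraph

/-! ### Shortest paths, potentials and signed steps on a cycle. -/

section Cycle

open scoped Fin.CommRing

variable {n : ℕ} [NeZero n] {G : WeightedDigraph (Fin n)}

/-- The weight of the path `v, v + 1, …, v + m`. -/
noncomputable def arcWeight (G : WeightedDigraph (Fin n)) (v : Fin n) (m : ℕ) : ℝ≥0∞ :=
  ∑ k ∈ Finset.range m, G.weight (v + (k : Fin n)) (v + (k : Fin n) + 1)

theorem arcWeight_add (v : Fin n) (k l : ℕ) :
    G.arcWeight v (k + l) = G.arcWeight v k + G.arcWeight (v + (k : Fin n)) l := by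
  simp only [arcWeight, Finset.sum_range_add, Nat.cast_add, add_assoc]

theorem arcWeight_mono (v : Fin n) : Monotone (G.arcWeight v) := fun k l h => by
  obtain ⟨m, rfl⟩ := Nat.exists_eq_add_of_le h
  rw [arcWeight_add]
  exact le_self_add

/-- A path of finite weight must advance by one at every step, so only its length is free. That
length is congruent to `v.stepsTo b` modulo `n`, and extra turns cannot lower the weight. -/
theorem IsConsistentlyOrientedCycle.shortestPath_eq (hG : G.IsConsistentlyOrientedCycle)
    (v b : Fin n) : G.shortestPath v b = G.arcWeight v (v.stepsTo b) := by
  apply le_antisymm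
  · refine iInf_le_of_le (v.stepsTo b) (iInf_le_of_le (fun i => v + ((i : ℕ) : Fin n))
      (iInf_le_of_le (by simp) (iInf_le_of_le ?_ ?_)))
    · exact Fin.add_stepsTo v b
    · rw [arcWeight, Finset.sum_range]
      refine le_of_eq (Finset.sum_congr rfl fun i _ => ?_)
      simp [add_assoc]
  · refine le_iInf fun m => le_iInf fun p => le_iInf fun h0 => le_iInf fun h1 => ?_
    by_cases hfin : ∀ i : Fin m, G.weight (p i.castSucc) (p i.succ) < ∞
    · have hp : ∀ i : Fin (m + 1), p i = v + ((i : ℕ) : Fin n) := by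
        intro i
        induction i using Fin.induction with
        | zero => simp [h0]
        | succ i ih =>
          rw [(hG _ _).1 (hfin i), ih]
          simp [add_assoc]
      have hle : v.stepsTo b ≤ m := by
        rw [← h1, hp, Fin.stepsTo_add_natCast]
        exact Nat.mod_le _ _
      refine (arcWeight_mono v hle).trans (le_of_eq ?_)
      rw [arcWeight, Finset.sum_range]
      refine Finset.sum_congr rfl fun i _ => ?_
      rw [hp, hp]
      simp [add_assoc]
    · push Not at hfin
      obtain ⟨i, hi⟩ := hfin
      exact le_top.trans (hi.trans (Finset.single_le_sum
        (f := fun i : Fin m => G.weight (p i.castSucc) (p i.succ))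
        (fun _ _ => zero_le) (Finset.mem_univ i)))

/-- A vertex on the arc from `v` to a vertex `b` that `v` sees is seen by `v` and sees `b`. -/
theorem IsConsistentlyOrientedCycle.rel_of_stepsTo_le (hG : G.IsConsistentlyOrientedCycle)
    {δ : ℝ≥0∞} {v a b : Fin n} (hb : G.pathCompletion.rel δ v b)
    (h : v.stepsTo a ≤ v.stepsTo b) :
    G.pathCompletion.rel δ v a ∧ G.pathCompletion.rel δ a b := by
  simp only [rel, pathCompletion, hG.shortestPath_eq] at hb ⊢
  refine ⟨(arcWeight_mono v h).trans hb, le_trans ?_ hb⟩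
  conv_rhs => rw [← Nat.add_sub_cancel' h, arcWeight_add, Fin.add_stepsTo]
  rw [Fin.stepsTo_eq_sub h]
  exact le_add_self

theorem IsConsistentlyOrientedCycle.rel_self (hG : G.IsConsistentlyOrientedCycle) (δ : ℝ≥0∞)
    (v : Fin n) : G.pathCompletion.rel δ v v := by
  simp only [rel, pathCompletion, hG.shortestPath_eq, Fin.stepsTo_eq_zero_iff.2]
  simp [arcWeight]

theorem rel_add_one {δ : ℝ≥0∞} (hδ : (⨆ i : Fin n, G.weight i (i + 1)) ≤ δ) (i : Fin n) :
    G.pathCompletion.rel δ i (i + 1) := by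
  refine le_trans ?_ ((le_iSup (fun i : Fin n => G.weight i (i + 1)) i).trans hδ)
  exact iInf_le_of_le 1 (iInf_le_of_le ![i, i + 1] (iInf_le_of_le rfl (iInf_le_of_le rfl
    (by simp))))

/-- A function on pairs of vertices that is additive on the sets of vertices seen by a common
vertex has a potential, provided that two distinct vertices see each other. -/
theorem IsConsistentlyOrientedCycle.exists_potential {δ : ℝ≥0∞}
    (hG : G.IsConsistentlyOrientedCycle) {M : Type*} [AddCommGroup M] (q : Fin n → Fin n → M)
    (hq : ∀ v a b c, G.pathCompletion.rel δ v a → G.pathCompletion.rel δ v b →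
      G.pathCompletion.rel δ v c → q a b + q b c = q a c)
    {y₁ y₂ : Fin n} (hy : y₁ ≠ y₂) (h₁ : G.pathCompletion.rel δ y₁ y₂)
    (h₂ : G.pathCompletion.rel δ y₂ y₁) :
    ∃ g : Fin n → M, ∀ v a b, G.pathCompletion.rel δ v a → G.pathCompletion.rel δ v b →
      q a b = g b - g a := by
  -- The cycle is unrolled to ℕ: `P` sums `q` over unit steps, and descends to `Fin n` exactly when
  -- a full turn `P n` vanishes.
  let P : ℕ → M := fun l => ∑ k ∈ Finset.range l, q (k : Fin n) (k + 1 : Fin n)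
  have hP : ∀ l, P (l + 1) = P l + q (l : Fin n) (l + 1 : Fin n) :=
    fun l => Finset.sum_range_succ _ _
  have hper : ∀ l, P (n + l) = P n + P l := by
    intro l
    simp [P, Finset.sum_range_add]
  have hself : ∀ v, q v v = 0 := fun v => by
    simpa using hq v v v v (hG.rel_self δ v) (hG.rel_self δ v) (hG.rel_self δ v)
  have harc : ∀ (l k : ℕ), k < n → G.pathCompletion.rel δ (l : Fin n) ((l + k : ℕ) : Fin n) →
      q (l : Fin n) ((l + k : ℕ) : Fin n) = P (l + k) - P l := by
    intro l k
    induction k with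
    | zero => intro _ _; simp [hself]
    | succ k ih =>
      intro hk h
      have hprev : G.pathCompletion.rel δ (l : Fin n) ((l + k : ℕ) : Fin n) := by
        refine (hG.rel_of_stepsTo_le h ?_).1
        rw [Nat.cast_add, Nat.cast_add, Fin.stepsTo_add_natCast, Fin.stepsTo_add_natCast,
          Nat.mod_eq_of_lt hk, Nat.mod_eq_of_lt (by omega)]
        omega
      have := hq _ _ _ _ (hG.rel_self δ _) hprev h
      rw [← this, ih (by omega) hprev, ← add_assoc, hP, Nat.cast_add (l + k) 1, Nat.cast_one]
      abel
  have harc' : ∀ v b, G.pathCompletion.rel δ v b →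
      q v b = P (v.val + v.stepsTo b) - P v.val := by
    intro v b h
    have hb : ((v.val + v.stepsTo b : ℕ) : Fin n) = b := by
      rw [Nat.cast_add, Fin.cast_val_eq_self, Fin.add_stepsTo]
    have := harc v.val (v.stepsTo b) (Fin.stepsTo_lt v b)
      (by rw [hb, Fin.cast_val_eq_self]; exact h)
    rwa [hb, Fin.cast_val_eq_self] at this
  have hmod : P n = 0 → ∀ l, P (l % n) = P l := by
    intro h0 l
    have hmul : ∀ m k, P (n * m + k) = P k := by
      intro m k
      induction m with
      | zero => simp
      | succ m ih => rw [Nat.mul_succ, add_comm (n * m), add_assoc, hper, h0, zero_add, ih]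
    conv_rhs => rw [← Nat.div_add_mod l n]
    exact (hmul _ _).symm
  have hval : ∀ v b : Fin n, (v.val + v.stepsTo b) % n = b.val := by
    intro v b
    rw [← Fin.val_natCast, Nat.cast_add, Fin.cast_val_eq_self, Fin.add_stepsTo]
  -- The second arc is lifted to start where the first ends, so it stops at `n + y₁`. The two values
  -- of `q` then add up to `P n`, and they cancel because `y₁` sees both endpoints.
  have hPn : P n = 0 := by
    have e₁ := harc' _ _ h₁
    have hsum := hq y₁ y₁ y₂ y₁ (hG.rel_self δ _) h₁ (hG.rel_self δ _)
    have e₂ := harc (y₁.val + y₁.stepsTo y₂) (y₂.stepsTo y₁) (Fin.stepsTo_lt _ _)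
    have c₂ : ((y₁.val + y₁.stepsTo y₂ : ℕ) : Fin n) = y₂ := by
      rw [Nat.cast_add, Fin.cast_val_eq_self, Fin.add_stepsTo]
    rw [Nat.cast_add (y₁.val + y₁.stepsTo y₂), c₂, Fin.add_stepsTo, add_assoc,
      Fin.stepsTo_add_stepsTo hy, add_comm y₁.val n, hper] at e₂
    rw [hself, e₁, e₂ h₂] at hsum
    rw [← hsum]
    abel
  have hv : ∀ v b, G.pathCompletion.rel δ v b → q v b = P b.val - P v.val := by
    intro v b h
    rw [harc' v b h, ← hmod hPn (v.val + _), hval]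
  refine ⟨fun a => P a.val, fun v a b ha hb => ?_⟩
  have := hq v v a b (hG.rel_self δ v) ha hb
  rw [hv v a ha, hv v b hb] at this
  rw [← sub_eq_iff_eq_add'.2 this.symm]
  abel

open Classical in
/-- The signed number of steps from `a` to `b`, measured in the direction in which one of the two
sees the other. -/
noncomputable def signedSteps (G : WeightedDigraph (Fin n)) (δ : ℝ≥0∞) (a b : Fin n) : ℝ :=
  if G.pathCompletion.rel δ a b then (a.stepsTo b : ℝ) else -(b.stepsTo a : ℝ)

/-- Of two vertices seen from `v`, the nearer sees the farther, and `hno` rules out the opposite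
direction unless they coincide. The resulting difference form makes alternation and the cocycle
identity immediate. -/
theorem IsConsistentlyOrientedCycle.signedSteps_eq {δ : ℝ≥0∞}
    (hG : G.IsConsistentlyOrientedCycle)
    (hno : ∀ a b : Fin n, G.pathCompletion.rel δ a b → G.pathCompletion.rel δ b a → a = b)
    {v a b : Fin n} (ha : G.pathCompletion.rel δ v a) (hb : G.pathCompletion.rel δ v b) :
    G.signedSteps δ a b = (v.stepsTo b : ℝ) - v.stepsTo a := by
  rcases le_total (v.stepsTo a) (v.stepsTo b) with h | h
  · rw [signedSteps, if_pos (hG.rel_of_stepsTo_le hb h).2, Fin.stepsTo_eq_sub h, Nat.cast_sub h]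
  · have hba := (hG.rel_of_stepsTo_le ha h).2
    by_cases hab : G.pathCompletion.rel δ a b
    · obtain rfl := hno a b hab hba
      rw [signedSteps, if_pos hab, Fin.stepsTo_eq_zero_iff.2 rfl]
      simp
    · rw [signedSteps, if_neg hab, Fin.stepsTo_eq_sub h, Nat.cast_sub h, neg_sub]

end Cycle

end WeightedDigraph

theorem mainTheorem4 (n : ℕ) [NeZero n] (hn : 2 ≤ n) (G : WeightedDigraph (Fin n))
    (hG : G.IsConsistentlyOrientedCycle) (δ : ℝ≥0∞) (hδ : (⨆ i : Fin n, G.weight i (i + 1)) ≤ δ) :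
    Subsingleton ((G.dowkerComplex δ).Homology 1) ↔
      ∃ y₁ y₂ : Fin n, y₁ ≠ y₂ ∧
        G.pathCompletion.weight y₁ y₂ ≤ δ ∧ G.pathCompletion.weight y₂ y₁ ≤ δ := by
  constructor
  · intro hK
    by_contra hno
    have hno' : ∀ a b : Fin n, G.pathCompletion.rel δ a b → G.pathCompletion.rel δ b a → a = b :=
      fun a b hab hba => by_contra fun hne => hno ⟨a, b, hne, hab, hba⟩
    have hsum := PreAbstractSimplicialComplex.sum_cocycle_eq_zero_of_subsingleton hK
      (G.signedSteps δ) ?_ ?_ Finset.univ (fun i : Fin n => i) (fun i => i + 1) ?_ ?_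
    · have hone : ∀ i : Fin n, G.signedSteps δ i (i + 1) = 1 := by
        intro i
        rw [WeightedDigraph.signedSteps, if_pos (WeightedDigraph.rel_add_one hδ i)]
        rw [Fin.stepsTo_add_one hn, Nat.cast_one]
      simp only [hone, Finset.sum_const, Finset.card_univ, Fintype.card_fin, nsmul_eq_mul,
        mul_one, Nat.cast_eq_zero] at hsum
      omega
    · rintro a b ⟨-, v, hv⟩
      rw [hG.signedSteps_eq hno' (hv a (by simp)) (hv b (by simp)),
        hG.signedSteps_eq hno' (hv b (by simp)) (hv a (by simp)), neg_sub]
    · rintro a b c ⟨-, v, hv⟩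
      rw [hG.signedSteps_eq hno' (hv a (by simp)) (hv b (by simp)),
        hG.signedSteps_eq hno' (hv b (by simp)) (hv c (by simp)),
        hG.signedSteps_eq hno' (hv a (by simp)) (hv c (by simp))]
      ring
    · intro i _
      refine ⟨by simp, i, fun x hx => ?_⟩
      rcases Finset.mem_insert.1 hx with rfl | hx
      · exact hG.rel_self δ x
      · rw [Finset.mem_singleton.1 hx]
        exact WeightedDigraph.rel_add_one hδ i
    -- The shift by one permutes the vertices, so the loop has zero boundary.
    · exact Equiv.sum_comp (Equiv.addRight (1 : Fin n)) fun i => (G.dowkerComplex δ).point i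
  · rintro ⟨y₁, y₂, hy, h₁, h₂⟩
    obtain ⟨g, hg⟩ := hG.exists_potential (δ := δ)
      (fun a b => (LinearMap.range ((G.dowkerComplex δ).boundary 1)).mkQ
        ((G.dowkerComplex δ).edge a b)) (by
        intro v a b c ha hb hc
        rw [← map_add, ← sub_eq_zero, ← map_sub, Submodule.mkQ_apply,
          Submodule.Quotient.mk_eq_zero]
        refine PreAbstractSimplicialComplex.edge_triangle_mem_range ⟨by simp, v, fun x hx => ?_⟩
        simp only [Finset.mem_insert, Finset.mem_singleton] at hx
        rcases hx with rfl | rfl | rfl <;> assumption) hy h₁ h₂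
    refine PreAbstractSimplicialComplex.subsingleton_homology_one_of_potential g ?_
    rintro a b ⟨-, v, hv⟩
    exact hg v a b (hv a (by simp)) (hv b (by simp))
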